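/- For $k\in\mathbb Z$ let $I_k(t)=\sum_{n\ge 0}\frac{1}{n!\,\Gamma(n+k+1)}\left(\frac t2\right)^{2n+k}$ (with $1/\Gamma=0$ at $0,-1,-2,\dots$) be the modified Bessel function, and let $G(m,t)=e^{-2t}I_m(2t)$, $m\in\mathbb Z$, be the semidiscrete heat kernel. For $h>0$ and $f:h\mathbb Z\to\mathbb R$, written $f_j$, $j\in\mathbb Z$, the semidiscrete heat semigroup is $e^{t\Delta_h}f_j=\sum_{m\in\mathbb Z}G(j-m,t/h^2)f_m$, and the fractional discrete integral is $$(-\Delta_h)^{-s}f_j=\frac1{\Gamma(s)}\int_0^\infty e^{t\Delta_h}f_j\,\frac{dt}{t^{1-s}} .$$ Define $$K_{-s}(m)=\frac1{\Gamma(s)}\int_0^\infty G(m,t)\,\frac{dt}{t^{1-s}},\qquad m\in\mathbb Z .$$ **Theorem.** Let $0<s<1/2$. The integral defining $K_{-s}(m)$ converges absolutely for every $m\in\mathbb Z$, and $K_{-s}$ is the kernel of $(-\Delta_h)^{-s}$: for all $h>0$, $j\in\mathbb Z$ and $f$ with $\sum_{m}|K_{-s}(j-m)f_m|<\infty$, the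 series for $e^{t\Delta_h}f_j$ converges absolutely for every $t>0$, the integral for $(-\Delta_h)^{-s}f_j$ converges absolutely, and $(-\Delta_h)^{-s}f_j=h^{2s}\sum_{m\in\mathbb Z}K_{-s}(j-m)f_m$. Explicitly, $$K_{-s}(m)=\frac{4^{-s}\,\Gamma(1/2-s)\,\Gamma(|m|+s)}{\sqrt\pi\,\Gamma(s)\,\Gamma(|m|+1-s)}\quad (m\in\mathbb Z\setminus\{0\}),\qquad K_{-s}(0)=\frac{4^{-s}\,\Gamma(1/2-s)}{\sqrt\pi\,\Gamma(1-s)} .$$ Moreover, with the positive constant $c_s=\dfrac{4^{-s}\,\Gamma(1/2-s)}{\sqrt\pi\,\Gamma(s)}$, there is a constant $C_s>0$, depending only on $s$, such that for all $m\in\mathbb Z\setminus\{0\}$ $$\left|K_{-s}(m)-\frac{c_s}{|m|^{1-2s}}\right|\le\frac{C_s}{|m|^{2-2s}} .$$ -/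

import Mathlib

noncomputable section

namespace FracDiscrete

/-- The modified Bessel function of the first kind of integer order `k`,
`I_k(t) = ∑_{n ≥ 0} (t/2)^(2n+k) / (n! Γ(n+k+1))`, where `1/Γ` vanishes at `0, -1, -2, …`
(Mathlib's `Real.Gamma` is `0` there, so its inverse is `0` as well). -/
def besselI (k : ℤ) (t : ℝ) : ℝ :=
  ∑' n : ℕ, (t / 2) ^ (2 * (n : ℤ) + k) / ((n.factorial : ℝ) * Real.Gamma ((n : ℝ) + (k : ℝ) + 1))

/-- The semidiscrete heat kernel `G(m,t) = e^{-2t} I_m(2t)` on `ℤ`. -/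
def heatKernel (m : ℤ) (t : ℝ) : ℝ :=
  Real.exp (-2 * t) * besselI m (2 * t)

/-- The semidiscrete heat semigroup `e^{tΔ_h} f` on the mesh `hℤ`; the function `f` on the mesh
is written as `j ↦ f_j`, `j ∈ ℤ`. -/
def heatSemigroup (h t : ℝ) (f : ℤ → ℝ) (j : ℤ) : ℝ :=
  ∑' m : ℤ, heatKernel (j - m) (t / h ^ 2) * f m

/-- The fractional discrete integral
`(-Δ_h)^{-s} f_j = (1/Γ(s)) ∫_0^∞ e^{tΔ_h} f_j dt / t^{1-s}`. -/
def fracIntegral (h s : ℝ) (f : ℤ → ℝ) (j : ℤ) : ℝ :=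
  1 / Real.Gamma s * ∫ t in Set.Ioi (0 : ℝ), heatSemigroup h t f j / t ^ (1 - s)

/-- The kernel `K_{-s}(m) = (1/Γ(s)) ∫_0^∞ G(m,t) dt / t^{1-s}` of the fractional discrete
integral. The first argument is `s`, not `-s`. -/
def fracIntegralKernel (s : ℝ) (m : ℤ) : ℝ :=
  1 / Real.Gamma s * ∫ t in Set.Ioi (0 : ℝ), heatKernel m t / t ^ (1 - s)

/-- The constant `4^{-s} Γ(1/2 - s) / (√π Γ(s))` of the leading term of `K_{-s}`. -/
def asympConst (s : ℝ) : ℝ :=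
  (4 : ℝ) ^ (-s) * Real.Gamma (1 / 2 - s) / (√Real.pi * Real.Gamma s)

end FracDiscrete

end

/-! ### Termwise integration of series -/

section

open MeasureTheory Filter Topology

/-! Inserting the Bessel series into the integral for $K_{-s}(m)$ gives terms $\int_0^\infty
t^{2n+|m|+s-1}e^{-2t}\,dt=2^{-(2n+|m|+s)}\Gamma(2n+|m|+s)$, all nonnegative. Legendre duplication
splits each $\Gamma(2n+|m|+s)$, turning the sum into a hypergeometric series at $1$ with
$a=(|m|+s)/2$, $b=a+1/2$, $c=|m|+1$. Gauss's theorem (`Real.hasSum_gauss`) sums it; its condition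
$c-a-b=1/2-s>0$ is exactly $s<1/2$. This is `heatKernel_mellin`.

The kernel property is Fubini for $h=1$ (`integral_tsum_heatKernel_mul`) followed by the scaling
$t\mapsto t/h^2$. Convergence of the semigroup series at every single $t$ needs the pointwise bound
`heatKernel_le_fracIntegralKernel`, uniform in $m$. The asymptotics come from log-convexity of
$\Gamma$ (`Real.abs_Gamma_add_div_Gamma_sub_rpow_le`). -/

theorem integrable_of_hasSum_of_summable_integral_norm {α ι : Type*} [MeasurableSpace α]
    {μ : Measure α} [Countable ι] {F : ι → α → ℝ} {f : α → ℝ}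
    (hF : ∀ i, Integrable (F i) μ) (hs : Summable fun i => ∫ a, ‖F i a‖ ∂μ)
    (hf : ∀ᵐ a ∂μ, HasSum (fun i => F i a) (f a)) : Integrable f μ := by
  refine ⟨aestronglyMeasurable_of_tendsto_ae (u := (atTop : Filter (Finset ι)))
    (f := fun s a => ∑ i ∈ s, F i a)
    (fun s => (integrable_finsetSum s fun i _ => hF i).aestronglyMeasurable) hf, ?_⟩
  have h1 : ∫⁻ a, ‖f a‖ₑ ∂μ ≤ ∫⁻ a, ∑' i, ‖F i a‖ₑ ∂μ := by
    refine lintegral_mono_ae ?_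
    filter_upwards [hf] with a ha
    rw [← ha.tsum_eq]
    exact enorm_tsum_le_tsum_enorm
  rw [lintegral_tsum fun i => (hF i).aestronglyMeasurable.enorm] at h1
  refine h1.trans_lt ?_
  have h2 : ∀ i, ∫⁻ a, ‖F i a‖ₑ ∂μ = ENNReal.ofReal (∫ a, ‖F i a‖ ∂μ) := fun i =>
    (ofReal_integral_norm_eq_lintegral_enorm (hF i)).symm
  simp_rw [h2]
  exact hs.tsum_ofReal_lt_top

theorem hasSum_integral_of_hasSum_of_nonneg {α ι : Type*} [MeasurableSpace α]
    {μ : Measure α} [Countable ι] {F : ι → α → ℝ} {f : α → ℝ}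
    (hF : ∀ i, AEStronglyMeasurable (F i) μ) (h0 : ∀ i, ∀ᵐ a ∂μ, 0 ≤ F i a)
    (hfi : Integrable f μ) (hf : ∀ᵐ a ∂μ, HasSum (fun i => F i a) (f a)) :
    HasSum (fun i => ∫ a, F i a ∂μ) (∫ a, f a ∂μ) := by
  refine hasSum_integral_of_dominated_convergence F hF (fun i => ?_) ?_ ?_ hf
  · filter_upwards [h0 i] with a ha
    -- Nonnegative terms serve as their own dominating functions; the sum of the bounds is `f`.
    rw [Real.norm_of_nonneg ha]
  · filter_upwards [hf] with a ha using ha.summable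
  · refine hfi.congr ?_
    filter_upwards [hf] with a ha using ha.tsum_eq.symm

theorem hasSum_integral_of_summable_integral_of_nonneg {α ι : Type*} [MeasurableSpace α]
    {μ : Measure α} [Countable ι] {F : ι → α → ℝ} {f : α → ℝ}
    (hF : ∀ i, Integrable (F i) μ) (h0 : ∀ i, ∀ᵐ a ∂μ, 0 ≤ F i a)
    (hs : Summable fun i => ∫ a, F i a ∂μ) (hf : ∀ᵐ a ∂μ, HasSum (fun i => F i a) (f a)) :
    Integrable f μ ∧ HasSum (fun i => ∫ a, F i a ∂μ) (∫ a, f a ∂μ) := by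
  have h : Integrable f μ := integrable_of_hasSum_of_summable_integral_norm hF (by
    refine hs.congr fun i => (integral_congr_ae ?_)
    filter_upwards [h0 i] with a ha
    rw [Real.norm_of_nonneg ha]) hf
  exact ⟨h, hasSum_integral_of_hasSum_of_nonneg (fun i => (hF i).1) h0 h hf⟩

/-! ### Beta integrals and Gauss's summation theorem -/

namespace Real

theorem integrableOn_beta {u v : ℝ} (hu : 0 < u) (hv : 0 < v) :
    IntegrableOn (fun x : ℝ => x ^ (u - 1) * (1 - x) ^ (v - 1)) (Set.Ioo 0 1) := by
  have h := Complex.betaIntegral_convergent (u := u) (v := v) (by simpa) (by simpa)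
  rw [intervalIntegrable_iff_integrableOn_Ioo_of_le zero_le_one] at h
  refine IntegrableOn.congr_fun h.re (fun x hx => ?_) measurableSet_Ioo
  have h1 : (0 : ℝ) ≤ 1 - x := by linarith [hx.2]
  have e : ((x : ℂ) ^ ((u : ℂ) - 1) * (1 - (x : ℂ)) ^ ((v : ℂ) - 1)) =
      ((x ^ (u - 1) * (1 - x) ^ (v - 1) : ℝ) : ℂ) := by
    push_cast [Complex.ofReal_cpow hx.1.le, Complex.ofReal_cpow h1]
    rfl
  rw [e]
  simp

theorem integral_beta {u v : ℝ} (hu : 0 < u) (hv : 0 < v) :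
    ∫ x in Set.Ioo (0 : ℝ) 1, x ^ (u - 1) * (1 - x) ^ (v - 1) =
      Gamma u * Gamma v / Gamma (u + v) := by
  have h := Complex.betaIntegral_eq_Gamma_mul_div u v (by simpa) (by simpa)
  rw [Complex.betaIntegral, intervalIntegral.integral_of_le zero_le_one,
    integral_Ioc_eq_integral_Ioo] at h
  rw [← Complex.ofReal_inj]
  push_cast [← Complex.Gamma_ofReal]
  rw [← h, ← integral_complex_ofReal]
  refine setIntegral_congr_fun measurableSet_Ioo fun x hx => ?_
  have h1 : (0 : ℝ) ≤ 1 - x := by linarith [hx.2]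
  push_cast [Complex.ofReal_cpow hx.1.le, Complex.ofReal_cpow h1]
  rfl

theorem Gamma_add_natCast_eq_ascPochhammer_mul {a : ℝ} (ha : 0 < a) (n : ℕ) :
    Gamma (a + n) = (ascPochhammer ℝ n).eval a * Gamma a := by
  induction n with
  | zero => simp
  | succ n ih =>
    rw [Nat.cast_succ, ← add_assoc, Gamma_add_one (by positivity), ih, ascPochhammer_succ_eval]
    ring

theorem hasSum_Gamma_add_div_factorial_mul_pow {a x : ℝ} (ha : 0 < a) (hx0 : 0 ≤ x) (hx : x < 1) :
    HasSum (fun n : ℕ => Gamma (a + n) / n.factorial * x ^ n) (Gamma a * (1 - x) ^ (-a)) := by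
  have h := (one_div_one_sub_rpow_hasFPowerSeriesOnBall_zero a).hasSum (y := x) (by
    rw [← ENNReal.ofReal_one, Metric.eball_ofReal]; simpa [abs_of_nonneg hx0] using hx)
  have h2 := h.mul_left (Gamma a)
  rw [zero_add, one_div, ← rpow_neg (by linarith)] at h2
  refine h2.congr_fun fun n => ?_
  have e := Ring.factorial_nsmul_multichoose_eq_ascPochhammer a n
  rw [Polynomial.ascPochhammer_smeval_eq_eval, Ring.multichoose_eq, nsmul_eq_mul] at e
  rw [Gamma_add_natCast_eq_ascPochhammer_mul ha, ← e]
  have := Nat.factorial_ne_zero n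
  simp
  field_simp

/-- **Gauss's summation theorem** for the hypergeometric series at `1`. -/
theorem hasSum_gauss {a b c : ℝ} (ha : 0 < a) (hb : 0 < b) (hcb : 0 < c - b) (habc : 0 < c - a - b) :
    HasSum (fun n : ℕ => Gamma (a + n) * Gamma (b + n) / (n.factorial * Gamma (c + n)))
      (Gamma a * Gamma b * Gamma (c - a - b) / (Gamma (c - a) * Gamma (c - b))) := by
  have key := hasSum_integral_of_hasSum_of_nonneg (μ := volume.restrict (Set.Ioo (0 : ℝ) 1))
    (F := fun (n : ℕ) x => Gamma (a + n) / n.factorial * (x ^ (b + n - 1) * (1 - x) ^ (c - b - 1)))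
    (f := fun x => Gamma a * (x ^ (b - 1) * (1 - x) ^ (c - a - b - 1)))
    (fun n => ((integrableOn_beta (by positivity) hcb).const_mul _).1)
    (fun n => (ae_restrict_iff' measurableSet_Ioo).2 (ae_of_all _ fun x hx => by
      have h1 : (0 : ℝ) ≤ 1 - x := by linarith [hx.2]
      have := hx.1
      have := (Gamma_pos_of_pos (show 0 < a + n by positivity)).le
      positivity))
    ((integrableOn_beta hb habc).const_mul _)
    ((ae_restrict_iff' measurableSet_Ioo).2 (ae_of_all _ fun x hx => by
      have h1 : (0 : ℝ) < 1 - x := by linarith [hx.2]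
      have h2 := (hasSum_Gamma_add_div_factorial_mul_pow ha hx.1.le hx.2).mul_right
        (x ^ (b - 1) * (1 - x) ^ (c - b - 1))
      have hv : Gamma a * (x ^ (b - 1) * (1 - x) ^ (c - a - b - 1)) =
          Gamma a * (1 - x) ^ (-a) * (x ^ (b - 1) * (1 - x) ^ (c - b - 1)) := by
        rw [show c - a - b - 1 = -a + (c - b - 1) by ring, rpow_add h1]
        ring
      rw [hv]
      refine h2.congr_fun fun n => ?_
      rw [show b + n - 1 = (b - 1) + n by ring, rpow_add hx.1, rpow_natCast]
      ring))
  simp_rw [integral_const_mul, integral_beta hb habc] at key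
  have key2 := key.div_const (Gamma (c - b))
  have hG := (Gamma_pos_of_pos hcb).ne'
  have hv : Gamma a * Gamma b * Gamma (c - a - b) / (Gamma (c - a) * Gamma (c - b)) =
      Gamma a * (Gamma b * Gamma (c - a - b) / Gamma (b + (c - a - b))) / Gamma (c - b) := by
    rw [show b + (c - a - b) = c - a by ring]
    field_simp
  rw [hv]
  refine key2.congr_fun fun n => ?_
  rw [integral_beta (by positivity) hcb, show b + n + (c - b) = c + n by ring]
  have := Nat.factorial_ne_zero n
  field_simp

/-! ### Asymptotics of Gamma quotients -/

theorem Gamma_add_le_rpow_mul_Gamma {x s : ℝ} (hx : 0 < x) (hs0 : 0 < s) (hs1 : s < 1) :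
    Gamma (x + s) ≤ x ^ s * Gamma x := by
  -- Log-convexity between $x$ and $x+1$, with weights $1-s$ and $s$.
  have h := Gamma_mul_add_mul_le_rpow_Gamma_mul_rpow_Gamma hx (show 0 < x + 1 by positivity)
    (show 0 < 1 - s by linarith) hs0 (by ring)
  have hG := Gamma_pos_of_pos hx
  rw [Gamma_add_one hx.ne', mul_rpow hx.le hG.le, show (1 - s) * x + s * (x + 1) = x + s by ring,
    mul_left_comm, ← rpow_add hG] at h
  simpa using h

theorem rpow_mul_Gamma_le_Gamma_add {x s : ℝ} (hx : 0 < x) (hs0 : 0 < s) (hs1 : s < 1) :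
    x / (x + 1) * (x ^ s * Gamma x) ≤ Gamma (x + s) := by
  have hxs : 0 < x + s := by positivity
  have hs1' : 0 < 1 - s := by linarith
  -- The upper bound, started at $x+s$ with increment $1-s$, lands on $\Gamma(x+1)=x\Gamma(x)$ and
  -- so becomes a lower bound for $\Gamma(x+s)$.
  have h := Gamma_add_le_rpow_mul_Gamma hxs hs1' (by linarith)
  rw [show x + s + (1 - s) = x + 1 by ring, Gamma_add_one hx.ne'] at h
  have hG := Gamma_pos_of_pos hx
  have hG' := Gamma_pos_of_pos hxs
  have h2 : (x + s) ^ (1 - s) ≤ (x + 1) ^ (1 - s) := by gcongr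
  have h3 : (x + 1) ^ (1 - s) * x ^ s ≤ x + 1 := by
    calc (x + 1) ^ (1 - s) * x ^ s ≤ (x + 1) ^ (1 - s) * (x + 1) ^ s := by gcongr; linarith
      _ = x + 1 := by rw [← rpow_add (by positivity)]; simp
  rw [div_mul_eq_mul_div, div_le_iff₀ (by positivity)]
  calc x * (x ^ s * Gamma x) = x ^ s * (x * Gamma x) := by ring
    _ ≤ x ^ s * ((x + s) ^ (1 - s) * Gamma (x + s)) := by gcongr
    _ ≤ x ^ s * ((x + 1) ^ (1 - s) * Gamma (x + s)) := by gcongr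
    _ = ((x + 1) ^ (1 - s) * x ^ s) * Gamma (x + s) := by ring
    _ ≤ (x + 1) * Gamma (x + s) := by gcongr
    _ = _ := by ring

/-- Numerator and denominator are compared with $x^s\Gamma(x)$ and $x^{1-s}\Gamma(x)$. The quotient
then lies between $x^{2s-1}\frac{x}{x+1}$ and $x^{2s-1}\frac{x+1}{x}$, hence within $x^{2s-2}$ of
$x^{2s-1}$; the factor $2$ is slack. -/
theorem abs_Gamma_add_div_Gamma_sub_rpow_le {x s : ℝ} (hx : 1 ≤ x) (hs0 : 0 < s) (hs1 : s < 1) :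
    |Gamma (x + s) / Gamma (x + 1 - s) - x ^ (2 * s - 1)| ≤ 2 * x ^ (2 * s - 2) := by
  have hx0 : 0 < x := by linarith
  have hs1' : 0 < 1 - s := by linarith
  have u1 := Gamma_add_le_rpow_mul_Gamma hx0 hs0 hs1
  have l1 := rpow_mul_Gamma_le_Gamma_add hx0 hs0 hs1
  have u2 := Gamma_add_le_rpow_mul_Gamma hx0 hs1' (by linarith)
  have l2 := rpow_mul_Gamma_le_Gamma_add hx0 hs1' (by linarith)
  rw [show x + (1 - s) = x + 1 - s by ring] at u2 l2
  have hB := Gamma_pos_of_pos (show 0 < x + 1 - s by linarith)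
  have hG := Gamma_pos_of_pos hx0
  set A := Gamma (x + s)
  set B := Gamma (x + 1 - s)
  set G := Gamma x
  have e1 : x ^ s = x ^ (2 * s - 1) * x ^ (1 - s) := by rw [← rpow_add hx0]; ring_nf
  have e2 : x ^ (2 * s - 1) = x * x ^ (2 * s - 2) := by
    rw [mul_comm x, ← rpow_add_one hx0.ne']
    congr 1
    ring
  set P := x ^ (2 * s - 1)
  set Q := x ^ (1 - s)
  have hP : 0 < P := by positivity
  have hQ : 0 < Q := by positivity
  rw [e1] at u1 l1
  have hPQ : P / x = x ^ (2 * s - 2) := by rw [e2]; field_simp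
  have lowB : x * (Q * G) ≤ (x + 1) * B := by
    rw [div_mul_eq_mul_div, div_le_iff₀ (by positivity)] at l2; linarith
  have lowA : x * (P * Q * G) ≤ (x + 1) * A := by
    rw [div_mul_eq_mul_div, div_le_iff₀ (by positivity)] at l1; linarith
  have up : A / B ≤ P * ((x + 1) / x) := by
    rw [div_le_iff₀ hB, mul_assoc, div_mul_eq_mul_div]
    refine u1.trans ?_
    rw [mul_assoc]
    gcongr
    rw [le_div_iff₀ hx0]; linarith
  have low : P * (x / (x + 1)) ≤ A / B := by
    rw [le_div_iff₀ hB]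
    have : P * (x / (x + 1)) * B ≤ P * (x / (x + 1)) * (Q * G) := by gcongr
    refine this.trans ?_
    rw [show P * (x / (x + 1)) * (Q * G) = x * (P * Q * G) / (x + 1) by ring,
      div_le_iff₀ (by positivity)]
    linarith
  have hx1 : P * ((x + 1) / x) = P + P / x := by field_simp
  have hx2 : P - P / x ≤ P * (x / (x + 1)) := by
    have : P * (x / (x + 1)) - (P - P / x) = P * (1 / (x * (x + 1))) := by field_simp; ring
    have : 0 ≤ P * (1 / (x * (x + 1))) := by positivity
    linarith
  have : 0 ≤ P / x := by positivity
  rw [← hPQ, abs_le]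
  constructor <;> linarith

end Real

/-! ### Bessel series and positivity of the heat kernel -/

namespace FracDiscrete

theorem summable_besselI_terms (m : ℕ) (x : ℝ) :
    Summable fun n : ℕ => x ^ (2 * n + m) / ((n.factorial : ℝ) * (n + m).factorial) := by
  refine Summable.of_norm_bounded ((Real.summable_pow_div_factorial (x ^ 2)).mul_left (|x| ^ m))
    fun n => ?_
  have h1 : (1 : ℝ) ≤ (n + m).factorial := by exact_mod_cast Nat.factorial_pos _
  have h2 : (0 : ℝ) < n.factorial := by exact_mod_cast Nat.factorial_pos _
  rw [norm_div, norm_mul, norm_pow, Real.norm_eq_abs, Real.norm_natCast, Real.norm_natCast,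
    pow_add, pow_mul, sq_abs, mul_comm _ (|x| ^ m), mul_div_assoc]
  gcongr
  exact le_mul_of_one_le_right h2.le h1

/-- The symmetry $I_{-m}=I_m$, which lets everything later depend only on $|k|$. -/
theorem hasSum_besselI (k : ℤ) (t : ℝ) :
    HasSum (fun n : ℕ => (t / 2) ^ (2 * n + k.natAbs) /
      ((n.factorial : ℝ) * (n + k.natAbs).factorial)) (besselI k t) := by
  have hs := summable_besselI_terms k.natAbs (t / 2)
  rw [besselI]
  obtain ⟨m, rfl | rfl⟩ := k.eq_nat_or_neg
  · simp only [Int.natAbs_natCast] at hs ⊢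
    convert hs.hasSum using 3 with n
    rw [Int.cast_natCast, ← Nat.cast_add, Real.Gamma_nat_eq_factorial]
    norm_cast
  · simp only [Int.natAbs_neg, Int.natAbs_natCast] at hs ⊢
    have h : HasSum (fun n : ℕ => (t / 2) ^ (2 * (n : ℤ) + -(m : ℤ)) /
        ((n.factorial : ℝ) * Real.Gamma ((n : ℝ) + ((-(m : ℤ) : ℤ) : ℝ) + 1)))
        (∑' n : ℕ, (t / 2) ^ (2 * n + m) / ((n.factorial : ℝ) * (n + m).factorial)) := by
      -- For order $-m$ the terms with $n<m$ vanish, since `Real.Gamma` is $0$ at $0,-1,-2,\dots$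
      -- and division by $0$ gives $0$. Shifting $n$ by $m$ then yields the series of order $m$.
      rw [← (add_left_injective m).hasSum_iff]
      · refine hs.hasSum.congr_fun fun n => ?_
        simp only [Function.comp_apply]
        rw [show ((n + m : ℕ) : ℝ) + ((-(m : ℤ) : ℤ) : ℝ) + 1 = n + 1 by push_cast; ring,
          Real.Gamma_nat_eq_factorial,
          show 2 * ((n + m : ℕ) : ℤ) + -(m : ℤ) = ((2 * n + m : ℕ) : ℤ) by push_cast; ring,
          zpow_natCast, mul_comm (n.factorial : ℝ)]
      · intro n hn
        have hnm : n < m := by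
          by_contra hc
          exact hn ⟨n - m, by simp only; omega⟩
        obtain ⟨d, rfl⟩ := Nat.exists_eq_add_of_lt hnm
        rw [show (n : ℝ) + ((-((n + d + 1 : ℕ) : ℤ) : ℤ) : ℝ) + 1 = -(d : ℝ) by push_cast; ring,
          Real.Gamma_neg_nat_eq_zero]
        simp
    rw [h.tsum_eq]
    exact hs.hasSum

theorem besselI_nonneg (k : ℤ) {t : ℝ} (ht : 0 ≤ t) : 0 ≤ besselI k t :=
  (hasSum_besselI k t).nonneg fun n => by positivity

theorem besselI_le_besselI (k : ℤ) {t u : ℝ} (ht : 0 ≤ t) (htu : t ≤ u) :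
    besselI k t ≤ besselI k u :=
  hasSum_le (fun n => by gcongr) (hasSum_besselI k t) (hasSum_besselI k u)

theorem heatKernel_nonneg (m : ℤ) {t : ℝ} (ht : 0 ≤ t) : 0 ≤ heatKernel m t :=
  mul_nonneg (Real.exp_pos _).le (besselI_nonneg m (by positivity))

/-! ### Mellin transform of the heat kernel -/

theorem hasSum_heatKernel_div_rpow (s : ℝ) (m : ℤ) {t : ℝ} (ht : 0 < t) :
    HasSum (fun n : ℕ => 1 / ((n.factorial : ℝ) * (n + m.natAbs).factorial) *
      (t ^ ((2 * n + m.natAbs + s) - 1) * Real.exp (-(2 * t)))) (heatKernel m t / t ^ (1 - s)) := by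
  have h := ((hasSum_besselI m (2 * t)).mul_left (Real.exp (-2 * t))).div_const (t ^ (1 - s))
  refine h.congr_fun fun n => ?_
  rw [show 2 * (n : ℝ) + m.natAbs + s - 1 = ((2 * n + m.natAbs : ℕ) : ℝ) - (1 - s) by
    push_cast; ring, Real.rpow_sub ht, Real.rpow_natCast,
    mul_div_cancel_left₀ t (two_ne_zero' ℝ), neg_mul]
  ring

theorem hasSum_heatKernel_mellin_terms {s : ℝ} (hs0 : 0 < s) (hs : s < 1 / 2) (m : ℕ) :
    HasSum (fun n : ℕ => 1 / ((n.factorial : ℝ) * (n + m).factorial) *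
      ((1 / 2) ^ (2 * n + m + s : ℝ) * Real.Gamma (2 * n + m + s)))
      ((4 : ℝ) ^ (-s) * Real.Gamma (1 / 2 - s) * Real.Gamma (m + s) /
        (√Real.pi * Real.Gamma (m + 1 - s))) := by
  have hm : (0 : ℝ) ≤ m := m.cast_nonneg
  -- Duplication at $z=(m+s)/2+n$ gives $\Gamma(z)\Gamma(z+1/2)=2^{1-2z}\sqrt\pi\,\Gamma(2z)$; the
  -- factor $1/(2\sqrt\pi)$ leaves $2^{-2z}\Gamma(2z)$.
  have h := (Real.hasSum_gauss (a := (m + s) / 2) (b := (m + s) / 2 + 1 / 2) (c := m + 1)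
    (by positivity) (by positivity) (by linarith) (by linarith)).mul_left (1 / (2 * √Real.pi))
  have hpi : √Real.pi ≠ 0 := (Real.sqrt_pos.2 Real.pi_pos).ne'
  have hv : (4 : ℝ) ^ (-s) * Real.Gamma (1 / 2 - s) * Real.Gamma (m + s) /
        (√Real.pi * Real.Gamma (m + 1 - s)) = 1 / (2 * √Real.pi) *
      (Real.Gamma ((m + s) / 2) * Real.Gamma ((m + s) / 2 + 1 / 2) *
        Real.Gamma (m + 1 - (m + s) / 2 - ((m + s) / 2 + 1 / 2)) /
        (Real.Gamma (m + 1 - (m + s) / 2) * Real.Gamma (m + 1 - ((m + s) / 2 + 1 / 2)))) := by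
    -- The arguments $c-a$ and $c-b$ also differ by $1/2$, so duplication collapses the denominator
    -- of Gauss's formula too.
    have e2 := Real.Gamma_mul_Gamma_add_half ((m + 1 - s) / 2)
    rw [Real.Gamma_mul_Gamma_add_half, mul_comm (Real.Gamma (m + 1 - (m + s) / 2)),
      show (m : ℝ) + 1 - ((m + s) / 2 + 1 / 2) = (m + 1 - s) / 2 by ring,
      show (m : ℝ) + 1 - (m + s) / 2 = (m + 1 - s) / 2 + 1 / 2 by ring, e2,
      show (m + 1 - s) / 2 + 1 / 2 - ((m + s) / 2 + 1 / 2) = 1 / 2 - s by ring,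
      show 2 * ((m + s) / 2) = m + s by ring, show 2 * ((m + 1 - s) / 2) = m + 1 - s by ring]
    have hG := (Real.Gamma_pos_of_pos (show 0 < m + 1 - s by linarith)).ne'
    have h4 : (4 : ℝ) ^ (-s) * 2 * 2 ^ (1 - (m + 1 - s)) = 2 ^ (1 - (m + s)) := by
      rw [show (4 : ℝ) = 2 ^ (2 : ℝ) by norm_num, ← Real.rpow_mul zero_le_two,
        ← Real.rpow_add_one two_ne_zero, ← Real.rpow_add zero_lt_two]
      congr 1
      ring
    rw [← h4]
    have : (2 : ℝ) ^ (1 - (m + 1 - s)) ≠ 0 := by positivity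
    field_simp
  rw [hv]
  refine h.congr_fun fun n => ?_
  rw [show (m + s) / 2 + 1 / 2 + n = (m + s) / 2 + n + 1 / 2 by ring,
    Real.Gamma_mul_Gamma_add_half, show 2 * ((m + s) / 2 + n) = 2 * n + m + s by ring,
    show (m : ℝ) + 1 + n = ((n + m : ℕ) : ℝ) + 1 by push_cast; ring, Real.Gamma_nat_eq_factorial,
    Real.rpow_sub zero_lt_two, Real.rpow_one, Real.div_rpow zero_le_one zero_le_two,
    Real.one_rpow]
  field_simp

theorem integrableOn_rpow_mul_exp_neg_mul {a r : ℝ} (ha : 0 < a) (hr : 0 < r) :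
    IntegrableOn (fun t : ℝ => t ^ (a - 1) * Real.exp (-(r * t))) (Set.Ioi 0) := by
  -- The integral of a non-integrable function is $0$ by convention, so a nonzero value proves
  -- integrability.
  refine Integrable.of_integral_ne_zero ?_
  rw [Real.integral_rpow_mul_exp_neg_mul_Ioi ha hr]
  have := Real.Gamma_pos_of_pos ha
  positivity

theorem heatKernel_mellin {s : ℝ} (hs0 : 0 < s) (hs : s < 1 / 2) (m : ℤ) :
    IntegrableOn (fun t : ℝ => heatKernel m t / t ^ (1 - s)) (Set.Ioi 0) ∧
    ∫ t in Set.Ioi (0 : ℝ), heatKernel m t / t ^ (1 - s) =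
      (4 : ℝ) ^ (-s) * Real.Gamma (1 / 2 - s) * Real.Gamma (|(m : ℝ)| + s) /
        (√Real.pi * Real.Gamma (|(m : ℝ)| + 1 - s)) := by
  have hsum := hasSum_heatKernel_mellin_terms hs0 hs m.natAbs
  have hint : ∀ n : ℕ, ∫ t in Set.Ioi (0 : ℝ),
      1 / ((n.factorial : ℝ) * (n + m.natAbs).factorial) *
        (t ^ ((2 * n + m.natAbs + s) - 1) * Real.exp (-(2 * t))) =
      1 / ((n.factorial : ℝ) * (n + m.natAbs).factorial) *
        ((1 / 2) ^ (2 * n + m.natAbs + s : ℝ) * Real.Gamma (2 * n + m.natAbs + s)) := fun n => by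
    rw [integral_const_mul, Real.integral_rpow_mul_exp_neg_mul_Ioi (by positivity) two_pos]
  have key := hasSum_integral_of_summable_integral_of_nonneg
    (μ := volume.restrict (Set.Ioi (0 : ℝ)))
    (F := fun (n : ℕ) t => 1 / ((n.factorial : ℝ) * (n + m.natAbs).factorial) *
      (t ^ ((2 * n + m.natAbs + s) - 1) * Real.exp (-(2 * t))))
    (f := fun t => heatKernel m t / t ^ (1 - s))
    (fun n => (integrableOn_rpow_mul_exp_neg_mul (by positivity) two_pos).const_mul _)
    (fun n => (ae_restrict_iff' measurableSet_Ioi).2 (ae_of_all _ fun t (ht : 0 < t) => by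
      positivity))
    (hsum.summable.congr fun n => (hint n).symm)
    ((ae_restrict_iff' measurableSet_Ioi).2 (ae_of_all _ fun t (ht : 0 < t) =>
      hasSum_heatKernel_div_rpow s m ht))
  refine ⟨key.1, ?_⟩
  simp only [hint] at key
  rw [key.2.unique hsum, Nat.cast_natAbs, Int.cast_abs]

theorem fracIntegralKernel_eq {s : ℝ} (hs0 : 0 < s) (hs : s < 1 / 2) (m : ℤ) :
    fracIntegralKernel s m =
      (4 : ℝ) ^ (-s) * Real.Gamma (1 / 2 - s) * Real.Gamma (|(m : ℝ)| + s) /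
        (√Real.pi * Real.Gamma s * Real.Gamma (|(m : ℝ)| + 1 - s)) := by
  rw [fracIntegralKernel, (heatKernel_mellin hs0 hs m).2, div_mul_div_comm, one_mul]
  ring_nf

theorem integral_heatKernel_eq {s : ℝ} (hs0 : 0 < s) (m : ℤ) :
    ∫ t in Set.Ioi (0 : ℝ), heatKernel m t / t ^ (1 - s) =
      Real.Gamma s * fracIntegralKernel s m := by
  have := (Real.Gamma_pos_of_pos hs0).ne'
  rw [fracIntegralKernel]
  field_simp

/-! ### The kernel of the fractional integral -/

/-- Only the part of the integral over $(t,t+1]$ is kept. There $I_m(2x)\ge I_m(2t)$, while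
$e^{-2x}$ loses at most the factor $e^2$ against $e^{-2t}$. The constant does not involve $m$, so
summability against $K_{-s}$ passes to the heat kernel at each time. -/
theorem heatKernel_le_fracIntegralKernel {s : ℝ} (hs0 : 0 < s) (hs : s < 1 / 2) (m : ℤ) {t : ℝ}
    (ht : 0 < t) :
    heatKernel m t ≤
      Real.exp 2 * (t + 1) ^ (1 - s) * Real.Gamma s * fracIntegralKernel s m := by
  have hi := (heatKernel_mellin hs0 hs m).1
  have hsub : Set.Ioc t (t + 1) ⊆ Set.Ioi 0 := fun x hx => ht.trans hx.1
  have h1 : ∫ _ in Set.Ioc t (t + 1),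
        Real.exp (-2 * (t + 1)) * besselI m (2 * t) / (t + 1) ^ (1 - s) ≤
      ∫ x in Set.Ioc t (t + 1), heatKernel m x / x ^ (1 - s) := by
    refine setIntegral_mono_on (by simp) (hi.mono_set hsub) measurableSet_Ioc fun x hx => ?_
    have hx0 : 0 < x := hsub hx
    rw [heatKernel]
    have hb := besselI_nonneg m (show 0 ≤ 2 * x by positivity)
    refine div_le_div₀ (by positivity) (mul_le_mul (Real.exp_le_exp.2 (by linarith [hx.2]))
      (besselI_le_besselI m (by positivity) (by linarith [hx.1]))
      (besselI_nonneg m (by positivity)) (by positivity)) (by positivity) ?_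
    exact Real.rpow_le_rpow hx0.le hx.2 (by linarith)
  have h2 : ∫ x in Set.Ioc t (t + 1), heatKernel m x / x ^ (1 - s) ≤
      ∫ x in Set.Ioi (0 : ℝ), heatKernel m x / x ^ (1 - s) := by
    refine setIntegral_mono_set hi ((ae_restrict_iff' measurableSet_Ioi).2
      (ae_of_all _ fun x (hx : 0 < x) => ?_)) hsub.eventuallyLE
    exact div_nonneg (heatKernel_nonneg m hx.le) (by positivity)
  have h3 := h1.trans h2
  rw [integral_heatKernel_eq hs0, setIntegral_const, Real.volume_real_Ioc_of_le (by linarith),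
    add_sub_cancel_left, one_smul, div_le_iff₀ (by positivity)] at h3
  have e : Real.exp (-2 * t) = Real.exp 2 * Real.exp (-2 * (t + 1)) := by
    rw [← Real.exp_add]; ring_nf
  rw [heatKernel, e, mul_assoc]
  calc _ ≤ Real.exp 2 * (Real.Gamma s * fracIntegralKernel s m * (t + 1) ^ (1 - s)) := by gcongr
    _ = _ := by ring

theorem summable_heatKernel_mul {s : ℝ} (hs0 : 0 < s) (hs : s < 1 / 2) {f : ℤ → ℝ} {j : ℤ}
    (hf : Summable fun m : ℤ => |fracIntegralKernel s (j - m) * f m|) {t : ℝ} (ht : 0 < t) :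
    Summable fun m : ℤ => heatKernel (j - m) t * f m := by
  refine Summable.of_norm_bounded
    (hf.mul_left (Real.exp 2 * (t + 1) ^ (1 - s) * Real.Gamma s)) fun m => ?_
  have h := heatKernel_le_fracIntegralKernel hs0 hs (j - m) ht
  rw [norm_mul, abs_mul, ← mul_assoc, Real.norm_of_nonneg (heatKernel_nonneg _ ht.le),
    Real.norm_eq_abs]
  refine mul_le_mul_of_nonneg_right (h.trans (mul_le_mul_of_nonneg_left (le_abs_self _) ?_))
    (abs_nonneg _)
  have := Real.Gamma_pos_of_pos hs0
  positivity

theorem integral_tsum_heatKernel_mul {s : ℝ} (hs0 : 0 < s) (hs : s < 1 / 2) {f : ℤ → ℝ} {j : ℤ}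
    (hf : Summable fun m : ℤ => |fracIntegralKernel s (j - m) * f m|) :
    IntegrableOn (fun t : ℝ => (∑' m : ℤ, heatKernel (j - m) t * f m) / t ^ (1 - s))
      (Set.Ioi 0) ∧
    ∫ t in Set.Ioi (0 : ℝ), (∑' m : ℤ, heatKernel (j - m) t * f m) / t ^ (1 - s) =
      Real.Gamma s * ∑' m : ℤ, fracIntegralKernel s (j - m) * f m := by
  have hF : ∀ m : ℤ, IntegrableOn (fun t : ℝ => heatKernel (j - m) t / t ^ (1 - s) * f m)
      (Set.Ioi 0) := fun m => (heatKernel_mellin hs0 hs (j - m)).1.mul_const _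
  have hnorm : ∀ m : ℤ, ∫ t in Set.Ioi (0 : ℝ), ‖heatKernel (j - m) t / t ^ (1 - s) * f m‖ =
      Real.Gamma s * fracIntegralKernel s (j - m) * |f m| := fun m => by
    rw [← integral_heatKernel_eq hs0, ← integral_mul_const]
    refine setIntegral_congr_fun measurableSet_Ioi fun t (ht : 0 < t) => ?_
    rw [norm_mul, Real.norm_of_nonneg (div_nonneg (heatKernel_nonneg _ ht.le) (by positivity)),
      Real.norm_eq_abs]
  have hsm : Summable fun m : ℤ =>
      ∫ t in Set.Ioi (0 : ℝ), ‖heatKernel (j - m) t / t ^ (1 - s) * f m‖ := by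
    refine Summable.of_norm_bounded (hf.mul_left (Real.Gamma s)) fun m => le_of_eq ?_
    rw [hnorm, norm_mul, norm_mul, abs_mul, Real.norm_of_nonneg (Real.Gamma_pos_of_pos hs0).le,
      Real.norm_eq_abs, Real.norm_eq_abs, abs_abs, mul_assoc]
  have hp : ∀ t : ℝ, 0 < t → HasSum (fun m : ℤ => heatKernel (j - m) t / t ^ (1 - s) * f m)
      ((∑' m : ℤ, heatKernel (j - m) t * f m) / t ^ (1 - s)) := fun t ht =>
    ((summable_heatKernel_mul hs0 hs hf ht).hasSum.div_const (t ^ (1 - s))).congr_fun fun m => by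
      ring
  refine ⟨integrable_of_hasSum_of_summable_integral_norm hF hsm
    ((ae_restrict_iff' measurableSet_Ioi).2 (ae_of_all _ fun t (ht : 0 < t) => hp t ht)), ?_⟩
  have h := (hasSum_integral_of_summable_integral_norm hF hsm).tsum_eq
  rw [← setIntegral_congr_fun measurableSet_Ioi fun t (ht : 0 < t) => (hp t ht).tsum_eq, ← h,
    ← tsum_mul_left]
  refine tsum_congr fun m => ?_
  rw [integral_mul_const, integral_heatKernel_eq hs0, mul_assoc]

theorem fracIntegral_eq {s : ℝ} (hs0 : 0 < s) (hs : s < 1 / 2) {h : ℝ} (hh : 0 < h) {f : ℤ → ℝ}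
    {j : ℤ} (hf : Summable fun m : ℤ => |fracIntegralKernel s (j - m) * f m|) :
    IntegrableOn (fun t : ℝ => heatSemigroup h t f j / t ^ (1 - s)) (Set.Ioi 0) ∧
    fracIntegral h s f j =
      h ^ (2 * s) * ∑' m : ℤ, fracIntegralKernel s (j - m) * f m := by
  obtain ⟨h1, h2⟩ := integral_tsum_heatKernel_mul hs0 hs hf
  set g : ℝ → ℝ := fun t => (∑' m : ℤ, heatKernel (j - m) t * f m) / t ^ (1 - s) with hg
  have hb : 0 < (h ^ 2)⁻¹ := by positivity
  -- Substituting $u=t/h^2$, the weight contributes $h^{-2(1-s)}$ and $dt$ contributes $h^2$, in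
  -- total $h^{2s}$.
  have heq : Set.EqOn (fun t : ℝ => ((h ^ 2)⁻¹) ^ (1 - s) * g ((h ^ 2)⁻¹ * t))
      (fun t : ℝ => heatSemigroup h t f j / t ^ (1 - s)) (Set.Ioi 0) := fun t (ht : 0 < t) => by
    simp only [hg, heatSemigroup]
    rw [Real.mul_rpow hb.le ht.le, show (h ^ 2)⁻¹ * t = t / h ^ 2 by ring]
    have : ((h ^ 2)⁻¹ : ℝ) ^ (1 - s) ≠ 0 := by positivity
    field_simp
  constructor
  · refine IntegrableOn.congr_fun (Integrable.const_mul ?_ _) heq measurableSet_Ioi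
    exact (integrableOn_Ioi_comp_mul_left_iff g 0 hb).2 (by rwa [mul_zero])
  · rw [fracIntegral, ← setIntegral_congr_fun measurableSet_Ioi heq, integral_const_mul,
      integral_comp_mul_left_Ioi g 0 hb, mul_zero, h2, smul_eq_mul]
    have e : ((h ^ 2)⁻¹ : ℝ) ^ (1 - s) * ((h ^ 2)⁻¹)⁻¹ = h ^ (2 * s) := by
      rw [← Real.rpow_neg_one ((h ^ 2)⁻¹), ← Real.rpow_add hb, Real.inv_rpow (by positivity),
        ← Real.rpow_neg (by positivity), ← Real.rpow_natCast, ← Real.rpow_mul hh.le]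
      congr 1
      push_cast
      ring
    rw [← e]
    have := (Real.Gamma_pos_of_pos hs0).ne'
    field_simp

/-! ### Asymptotics of the kernel -/

theorem asympConst_pos {s : ℝ} (hs0 : 0 < s) (hs : s < 1 / 2) : 0 < asympConst s := by
  have h1 := Real.Gamma_pos_of_pos hs0
  have h2 := Real.Gamma_pos_of_pos (show 0 < 1 / 2 - s by linarith)
  rw [asympConst]
  positivity

theorem abs_fracIntegralKernel_sub_le {s : ℝ} (hs0 : 0 < s) (hs : s < 1 / 2) {m : ℤ}
    (hm : m ≠ 0) :
    |fracIntegralKernel s m - asympConst s / |(m : ℝ)| ^ (1 - 2 * s)| ≤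
      2 * asympConst s / |(m : ℝ)| ^ (2 - 2 * s) := by
  have hc := asympConst_pos hs0 hs
  have hm1 : (1 : ℝ) ≤ |(m : ℝ)| := by exact_mod_cast Int.one_le_abs hm
  have h0 : 0 ≤ |(m : ℝ)| := abs_nonneg _
  have h := Real.abs_Gamma_add_div_Gamma_sub_rpow_le hm1 hs0 (by linarith)
  have e : fracIntegralKernel s m - asympConst s / |(m : ℝ)| ^ (1 - 2 * s) = asympConst s *
      (Real.Gamma (|(m : ℝ)| + s) / Real.Gamma (|(m : ℝ)| + 1 - s) - |(m : ℝ)| ^ (2 * s - 1)) := by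
    rw [fracIntegralKernel_eq hs0 hs, asympConst, show 2 * s - 1 = -(1 - 2 * s) by ring,
      Real.rpow_neg h0]
    ring
  rw [e, abs_mul, abs_of_pos hc]
  calc _ ≤ asympConst s * (2 * |(m : ℝ)| ^ (2 * s - 2)) := by gcongr
    _ = _ := by
      rw [show 2 * s - 2 = -(2 - 2 * s) by ring, Real.rpow_neg h0]
      ring

end FracDiscrete

end

theorem theorem4p1 (s : ℝ) (hs0 : 0 < s) (hs : s < 1 / 2) :
    -- the integrals that define the kernel converge
    (∀ m : ℤ, MeasureTheory.IntegrableOn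
      (fun t : ℝ => FracDiscrete.heatKernel m t / t ^ (1 - s)) (Set.Ioi 0)) ∧
    -- it is the convolution kernel of the fractional discrete integral
    (∀ (h : ℝ) (f : ℤ → ℝ) (j : ℤ), 0 < h →
      Summable (fun m : ℤ => |FracDiscrete.fracIntegralKernel s (j - m) * f m|) →
        (∀ t : ℝ, 0 < t →
          Summable (fun m : ℤ => FracDiscrete.heatKernel (j - m) (t / h ^ 2) * f m)) ∧
        MeasureTheory.IntegrableOn
          (fun t : ℝ => FracDiscrete.heatSemigroup h t f j / t ^ (1 - s)) (Set.Ioi 0) ∧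
        FracDiscrete.fracIntegral h s f j =
          h ^ (2 * s) * ∑' m : ℤ, FracDiscrete.fracIntegralKernel s (j - m) * f m) ∧
    -- the explicit expression
    (∀ m : ℤ, m ≠ 0 →
      FracDiscrete.fracIntegralKernel s m =
        (4 : ℝ) ^ (-s) * Real.Gamma (1 / 2 - s) * Real.Gamma (|(m : ℝ)| + s) /
          (√Real.pi * Real.Gamma s * Real.Gamma (|(m : ℝ)| + 1 - s))) ∧
    FracDiscrete.fracIntegralKernel s 0 =
      (4 : ℝ) ^ (-s) * Real.Gamma (1 / 2 - s) / (√Real.pi * Real.Gamma (1 - s)) ∧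
    -- the asymptotic estimate
    0 < FracDiscrete.asympConst s ∧
    (∃ C : ℝ, 0 < C ∧ ∀ m : ℤ, m ≠ 0 →
      |FracDiscrete.fracIntegralKernel s m -
          FracDiscrete.asympConst s / |(m : ℝ)| ^ (1 - 2 * s)| ≤
        C / |(m : ℝ)| ^ (2 - 2 * s)) := by
  refine ⟨fun m => (FracDiscrete.heatKernel_mellin hs0 hs m).1, fun h f j hh hf =>
    ⟨fun t ht => FracDiscrete.summable_heatKernel_mul hs0 hs hf (by positivity),
      FracDiscrete.fracIntegral_eq hs0 hs hh hf⟩,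
    fun m _ => FracDiscrete.fracIntegralKernel_eq hs0 hs m, ?_,
    FracDiscrete.asympConst_pos hs0 hs, 2 * FracDiscrete.asympConst s,
    mul_pos two_pos (FracDiscrete.asympConst_pos hs0 hs),
    fun m hm => FracDiscrete.abs_fracIntegralKernel_sub_le hs0 hs hm⟩
  -- At $m=0$ the factor $\Gamma(|m|+s)$ is $\Gamma(s)$ and cancels.
  have := (Real.Gamma_pos_of_pos hs0).ne'
  rw [FracDiscrete.fracIntegralKernel_eq hs0 hs]
  simp only [Int.cast_zero, abs_zero, zero_add]
  field_simp
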